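/- For $z\in\mathbb{C}$ with $|z|\le 1$, $z\ne 1$, and $v\in\mathbb{C}\setminus\{0,-1,-2,\dots\}$, let $\Phi(z,s,v)$ be the Hurwitz–Lerch zeta function, i.e. the analytic continuation in $s$ of the series $\sum_{k=0}^{\infty} z^k (v+k)^{-s}$ (principal powers), which converges absolutely for $\operatorname{Re} s>1$; write $\Phi'(z,s,v)=\partial\Phi(z,s,v)/\partial s$. Let $n\ge 0$ be an integer and let $x\in\mathbb{C}\setminus\{0,-1,-2,\dots\}$. Then, for $0\le j\le 2n$, the function $s\mapsto\Phi\left(-e^{2i\pi j/(2n+1)},s,x\right)$ is complex differentiable at $s=0$, and $$\prod_{j=0}^{2n}\exp\left(\frac{(-1)^{j-n}\,e^{\frac{i\pi j}{2n+1}}\,\Phi'\left(-e^{\frac{2i\pi j}{2n+1}},0,x\right)}{2n+1}\right)=\frac{1}{\sqrt{2(2n+1)}}\,\frac{\Gamma\left(\frac{n+x}{4n+2}\right)}{\Gamma\left(\frac{3n+x+1}{4n+2}\right)}.$$ If moreover $\operatorname{Re} x>-n$, then $z\mapsto z^{\frac{n+x}{4n+2}-1}(z+1)^{-\frac{3n+x+1}{4n+2}}$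 is integrable on $(0,\infty)$ and $$\prod_{j=0}^{2n}\exp\left(\frac{(-1)^{j-n}\,e^{\frac{i\pi j}{2n+1}}\,\Phi'\left(-e^{\frac{2i\pi j}{2n+1}},0,x\right)}{2n+1}\right)=\frac{1}{\sqrt{2\pi}\,\sqrt{2n+1}}\int_0^\infty\frac{z^{\frac{n+x}{4n+2}-1}}{(z+1)^{\frac{3n+x+1}{4n+2}}}\,dz .$$ -/

import Mathlib

/-- `F` is a holomorphic continuation, in the variable `s`, of the Hurwitz-Lerch series
`∑ k, z ^ k * (v + k) ^ (-s)` (principal powers) from the half-plane `1 < re s` of absolute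
convergence to the half-plane `σ < re s`. -/
structure IsLerchContinuation (z v : ℂ) (σ : ℝ) (F : ℂ → ℂ) : Prop where
  differentiableOn : DifferentiableOn ℂ F {s : ℂ | σ < s.re}
  hasSum : ∀ s : ℂ, σ < s.re → 1 < s.re →
    HasSum (fun k : ℕ => z ^ k * (v + (k : ℂ)) ^ (-s)) (F s)

/-- Two continuations agree wherever both are defined. -/
theorem IsLerchContinuation.eq {z v : ℂ} {σ τ : ℝ} {F G : ℂ → ℂ}
    (hF : IsLerchContinuation z v σ F) (hG : IsLerchContinuation z v τ G)
    {s : ℂ} (hσ : σ < s.re) (hτ : τ < s.re) : F s = G s := by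
  have hopen : ∀ a : ℝ, IsOpen {w : ℂ | a < w.re} := fun a =>
    isOpen_lt continuous_const Complex.continuous_re
  have hF' : AnalyticOnNhd ℂ F {w : ℂ | max σ τ < w.re} :=
    (hF.differentiableOn.mono fun w (hw : max σ τ < w.re) =>
      lt_of_le_of_lt (le_max_left σ τ) hw).analyticOnNhd (hopen _)
  have hG' : AnalyticOnNhd ℂ G {w : ℂ | max σ τ < w.re} :=
    (hG.differentiableOn.mono fun w (hw : max σ τ < w.re) =>
      lt_of_le_of_lt (le_max_right σ τ) hw).analyticOnNhd (hopen _)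
  have hconn : IsPreconnected {w : ℂ | max σ τ < w.re} :=
    (convex_halfSpace_re_gt (max σ τ)).isPreconnected
  obtain ⟨b, hb⟩ : ∃ b : ℝ, max (max σ τ) 1 < b := exists_gt _
  have hb0 : max σ τ < b := lt_of_le_of_lt (le_max_left _ _) hb
  have hev : F =ᶠ[nhds (b : ℂ)] G := by
    filter_upwards [(hopen (max (max σ τ) 1)).mem_nhds (by simpa using hb)] with w hw
    have hw' : max (max σ τ) 1 < w.re := hw
    simp only [max_lt_iff] at hw'
    exact (hF.hasSum w hw'.1.1 hw'.2).unique (hG.hasSum w hw'.1.2 hw'.2)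
  exact hF'.eqOn_of_preconnected_of_eventuallyEq hG' hconn
    (show max σ τ < ((b : ℂ)).re by simpa using hb0) hev (max_lt hσ hτ)

open Classical in
/-- The Hurwitz-Lerch zeta function `Φ(z, s, v)` for `|z| ≤ 1`, `z ≠ 1` and `v ≠ 0, -1, -2, …`:
the value at `s` of the analytic continuation in `s` of `∑ k, z ^ k * (v + k) ^ (-s)`
(and `0` if the series has no continuation to a half-plane containing `s`). -/
noncomputable def lerchPhi (z s v : ℂ) : ℂ :=
  if h : ∃ c : ℂ, ∃ (σ : ℝ) (F : ℂ → ℂ), σ < s.re ∧ IsLerchContinuation z v σ F ∧ F s = c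
  then h.choose else 0

/-- Any continuation computes `Φ`; the value does not depend on the choice made above. -/
theorem IsLerchContinuation.lerchPhi_eq {z v : ℂ} {σ : ℝ} {F : ℂ → ℂ}
    (hF : IsLerchContinuation z v σ F) {s : ℂ} (hs : σ < s.re) : lerchPhi z s v = F s := by
  have h : ∃ c : ℂ, ∃ (σ : ℝ) (F : ℂ → ℂ), σ < s.re ∧ IsLerchContinuation z v σ F ∧ F s = c :=
    ⟨F s, σ, F, hs, hF, rfl⟩
  obtain ⟨τ, G, hτ, hG, hGs⟩ := h.choose_spec
  rw [lerchPhi, dif_pos h, ← hGs]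
  exact hG.eq hF hτ hs

/-- The derivative `Φ'(z, s, v) = ∂Φ(z, s, v)/∂s` in the second argument. -/
noncomputable def lerchPhiDeriv (z s v : ℂ) : ℂ :=
  deriv (fun w : ℂ => lerchPhi z w v) s

/-- The product over `j = 0, …, 2n` of
`exp ((-1)^(j-n) e^{iπj/(2n+1)} Φ'(-e^{2iπj/(2n+1)}, 0, x) / (2n+1))`. -/
noncomputable def lerchExpProduct (n : ℕ) (x : ℂ) : ℂ :=
  ∏ j ∈ Finset.range (2 * n + 1),
    Complex.exp ((-1 : ℂ) ^ ((j : ℤ) - (n : ℤ))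
      * Complex.exp (Complex.I * Real.pi * j / (2 * n + 1))
      * lerchPhiDeriv (-Complex.exp (2 * Complex.I * Real.pi * j / (2 * n + 1))) 0 x
      / (2 * n + 1))

/-!
For `re v ≥ 1`, `N` summations by parts turn the Lerch series into a series of `N`-th differences
of `w ↦ w ^ (-s)`, of size `O((re v + k) ^ (-re s - N))`. This continues `Φ(z, ·, v)` to
`re s > 1 - N`, hence to `ℂ` and, through `Φ(z, s, v) = v ^ (-s) + z Φ(z, s, v + 1)`, to every `v`;
it also gives `Φ'(z, 0, v + m) = -log (v + m) / (1 - z) + o(1)` as `m → ∞`.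

For `z = -1` the functional equation makes `exp Φ'(-1, 0, y) · Γ((y + 1) / 2) / Γ(y / 2)` invariant
under `y ↦ y + 2`, and the asymptotics identify its value as `1 / √2`. Filtering the Lerch
series by residue classes modulo `2n + 1` with roots of unity reduces the whole product to
`Φ'(-1, 0, (x + n) / (2n + 1))`. The integral is a beta function.
-/

open Complex Filter Topology

/-- The `N`-th forward difference `Δ ^ N` (with step `1`) of the power `u ↦ u ^ (-s)`. -/
noncomputable def cpowNegDiff (N : ℕ) (s u : ℂ) : ℂ :=
  (fwdDiff 1)^[N] (fun w : ℂ => w ^ (-s)) u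

theorem cpowNegDiff_zero (s u : ℂ) : cpowNegDiff 0 s u = u ^ (-s) := rfl

theorem cpowNegDiff_succ (N : ℕ) (s u : ℂ) :
    cpowNegDiff (N + 1) s u = cpowNegDiff N s (u + 1) - cpowNegDiff N s u := by
  rw [cpowNegDiff, Function.iterate_succ_apply', fwdDiff]
  rfl

theorem hasDerivAt_cpowNegDiff (N : ℕ) (s : ℂ) {u : ℂ} (hu : 0 < u.re) :
    HasDerivAt (cpowNegDiff N s) (-s * cpowNegDiff N (s + 1) u) u := by
  induction N generalizing u with
  | zero =>
    have h := (hasDerivAt_id u).cpow_const (c := -s) (.inl hu)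
    rw [show -s - 1 = -(s + 1) by ring, mul_one] at h
    exact h
  | succ N ih =>
    have hu' : 0 < (u + 1).re := by simpa using hu.trans (lt_add_one _)
    have h := ((ih hu').comp_add_const u 1).sub (ih hu)
    rw [← mul_sub, ← cpowNegDiff_succ] at h
    exact h.congr_of_eventuallyEq (.of_forall fun w => cpowNegDiff_succ N s w)

theorem differentiable_const_cpow_neg {u : ℂ} (hu : u ≠ 0) :
    Differentiable ℂ fun s : ℂ => u ^ (-s) :=
  differentiable_neg.const_cpow (.inl hu)

theorem differentiable_cpowNegDiff (N : ℕ) {u : ℂ} (hu : 0 < u.re) :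
    Differentiable ℂ fun s : ℂ => cpowNegDiff N s u := by
  induction N generalizing u with
  | zero => exact differentiable_const_cpow_neg (ne_zero_of_re_pos hu)
  | succ N ih =>
    simp only [cpowNegDiff_succ]
    exact (ih (by simpa using hu.trans (lt_add_one _))).sub (ih hu)

theorem norm_cpow_neg_le {s w : ℂ} {σ a R : ℝ} (ha : 1 ≤ a) (hw : a ≤ w.re) (hσ : 0 ≤ σ)
    (hs : σ ≤ s.re) (hR : ‖s‖ ≤ R) : ‖w ^ (-s)‖ ≤ Real.exp (Real.pi * R) * a ^ (-σ) := by
  have hw0 : w ≠ 0 := ne_zero_of_re_pos (by linarith)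
  have hwa : a ≤ ‖w‖ := hw.trans (re_le_norm w)
  have harg : arg w * s.im ≤ Real.pi * R :=
    calc arg w * s.im ≤ |arg w| * |s.im| := (le_abs_self _).trans (abs_mul _ _).le
      _ ≤ Real.pi * R := by gcongr; exacts [abs_arg_le_pi w, (abs_im_le_norm s).trans hR]
  have hmod : ‖w‖ ^ (-s.re) ≤ a ^ (-σ) :=
    calc ‖w‖ ^ (-s.re) ≤ ‖w‖ ^ (-σ) := by gcongr; exact ha.trans hwa
      _ ≤ a ^ (-σ) := Real.rpow_le_rpow_of_nonpos (by linarith) hwa (by linarith)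
  rw [norm_cpow_of_ne_zero hw0, neg_re, neg_im, mul_neg, Real.exp_neg, div_inv_eq_mul, mul_comm]
  gcongr

/-- Each difference costs a factor `s` and gains a power of `a`, by the mean value inequality. -/
theorem norm_cpowNegDiff_le {N : ℕ} {s w : ℂ} {σ a R : ℝ} (ha : 1 ≤ a) (hw : a ≤ w.re)
    (hσ : 0 ≤ σ + N) (hs : σ ≤ s.re) (hR : ‖s‖ + N ≤ R) :
    ‖cpowNegDiff N s w‖ ≤ Real.exp (Real.pi * R) * R ^ N * a ^ (-(σ + N)) := by
  induction N generalizing s σ w with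
  | zero =>
    simp only [Nat.cast_zero, add_zero, pow_zero, mul_one] at *
    exact norm_cpow_neg_le ha hw hσ hs hR
  | succ N ih =>
    push_cast at hσ hR ⊢
    have hsR : ‖s‖ ≤ R := by linarith [N.cast_nonneg (α := ℝ)]
    have hderiv : ∀ u ∈ {u : ℂ | a ≤ u.re},
        ‖-s * cpowNegDiff N (s + 1) u‖ ≤
          R * (Real.exp (Real.pi * R) * R ^ N * a ^ (-(σ + 1 + N))) := fun u hu => by
      rw [norm_mul, norm_neg]
      refine mul_le_mul hsR (ih hu (by linarith) (by simpa using hs) ?_) (norm_nonneg _)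
        ((norm_nonneg s).trans hsR)
      linarith [norm_add_le s 1, norm_one (α := ℂ)]
    have hw' : a ≤ (w + 1).re := by
      rw [add_re, one_re]
      linarith
    have hmv := (convex_halfSpace_re_ge a).norm_image_sub_le_of_norm_hasDerivWithin_le
      (fun _ hu => (hasDerivAt_cpowNegDiff N s
        (zero_lt_one.trans_le (ha.trans hu))).hasDerivWithinAt) hderiv hw hw'
    rw [cpowNegDiff_succ]
    refine hmv.trans_eq ?_
    rw [add_sub_cancel_left, norm_one, mul_one, show σ + (N + 1) = σ + 1 + N by ring]
    ring

theorem hasSum_pow_mul_fwdDiff {R : Type*} [CommRing R] [TopologicalSpace R] [IsTopologicalRing R]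
    {z S : R} {a : ℕ → R} (h : HasSum (fun k => z ^ k * a k) S) :
    HasSum (fun k => z ^ (k + 1) * fwdDiff 1 a k) ((1 - z) * S - a 0) := by
  have hshift : HasSum (fun k => z ^ (k + 1) * a (k + 1)) (S - a 0) := by
    simpa using (hasSum_nat_add_iff' 1).mpr h
  have hsub := hshift.sub (h.mul_left z)
  rw [show S - a 0 - z * S = (1 - z) * S - a 0 by ring] at hsub
  refine hsub.congr_fun fun k => ?_
  rw [fwdDiff]
  ring

/-- Euler's transformation of a power series: `N` summations by parts. -/
theorem hasSum_pow_mul_fwdDiff_iterate {𝕜 : Type*} [Field 𝕜] [TopologicalSpace 𝕜]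
    [IsTopologicalRing 𝕜] {z S : 𝕜} {a : ℕ → 𝕜} (hz : z ≠ 1)
    (h : HasSum (fun k => z ^ k * a k) S) (N : ℕ) :
    HasSum (fun k => z ^ (k + N) * (fwdDiff 1)^[N] a k)
      ((1 - z) ^ N * (S - ∑ i ∈ Finset.range N, z ^ i / (1 - z) ^ (i + 1) *
        (fwdDiff 1)^[i] a 0)) := by
  induction N with
  | zero => simpa using h
  | succ N ih =>
    have hz' : 1 - z ≠ 0 := sub_ne_zero.mpr hz.symm
    have hstep := hasSum_pow_mul_fwdDiff (a := fun k => z ^ N * (fwdDiff 1)^[N] a k)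
      (ih.congr_fun fun k => by ring)
    convert hstep using 1
    · ext k
      rw [Function.iterate_succ_apply', fwdDiff, fwdDiff]
      ring
    · have hlast : (1 - z) ^ (N + 1) * (z ^ N / (1 - z) ^ (N + 1) * (fwdDiff 1)^[N] a 0) =
          z ^ N * (fwdDiff 1)^[N] a 0 := by field_simp [hz']
      rw [Finset.sum_range_succ]
      linear_combination -hlast

theorem fwdDiff_iterate_cpow_neg_add_natCast (N : ℕ) (s v : ℂ) (k : ℕ) :
    (fwdDiff 1)^[N] (fun k : ℕ => (v + k) ^ (-s)) k = cpowNegDiff N s (v + k) := by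
  induction N generalizing k with
  | zero => rfl
  | succ N ih =>
    rw [Function.iterate_succ_apply', fwdDiff, ih, ih, cpowNegDiff_succ]
    push_cast
    rw [add_assoc]

theorem add_natCast_re (v : ℂ) (k : ℕ) : (v + k).re = v.re + k := by
  rw [add_re, natCast_re]

theorem norm_pow_mul_cpowNegDiff_le {N : ℕ} {z v s : ℂ} {σ b R : ℝ} (hz : ‖z‖ ≤ 1) (hb : 1 ≤ b)
    (hv : b ≤ v.re) (hσ : 1 < σ + N) (hs : σ < s.re) (hR : s ∈ Metric.ball 0 R) (k : ℕ) :
    ‖z ^ (k + N) * cpowNegDiff N s (v + k)‖ ≤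
      Real.exp (Real.pi * (R + N)) * (R + N) ^ N * (k + b) ^ (-(σ + N)) := by
  rw [mem_ball_zero_iff] at hR
  rw [norm_mul, norm_pow]
  refine (mul_le_of_le_one_left (norm_nonneg _) (pow_le_one₀ (norm_nonneg z) hz)).trans ?_
  refine norm_cpowNegDiff_le ?_ ?_ (by linarith) hs.le (by linarith)
  · linarith [k.cast_nonneg (α := ℝ)]
  · rw [add_natCast_re]
    linarith

theorem isOpen_re_gt_inter_ball (σ R : ℝ) :
    IsOpen ({s : ℂ | σ < s.re} ∩ Metric.ball 0 R) :=
  (isOpen_lt continuous_const continuous_re).inter Metric.isOpen_ball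

/-- The remainder of the Lerch series after `N` steps of Euler's transformation. -/
noncomputable def lerchEulerTail (N : ℕ) (z v s : ℂ) : ℂ :=
  ∑' k : ℕ, z ^ (k + N) * cpowNegDiff N s (v + k)

/-- The Lerch series after `N` steps of Euler's transformation: the tail now converges for
`1 < re s + N`. -/
noncomputable def lerchEuler (N : ℕ) (z v s : ℂ) : ℂ :=
  ∑ i ∈ Finset.range N, z ^ i / (1 - z) ^ (i + 1) * cpowNegDiff i s v +
    lerchEulerTail N z v s / (1 - z) ^ N

theorem summable_const_mul_natCast_add_rpow (C : ℝ) {b p : ℝ} (hb : 0 < b) (hp : 1 < p) :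
    Summable fun k : ℕ => C * ((k : ℝ) + b) ^ (-p) := by
  refine (((Real.summable_one_div_nat_add_rpow b p).mpr hp).congr fun k => ?_).mul_left C
  have hkb : 0 < k + b := by positivity
  rw [abs_of_pos hkb, Real.rpow_neg hkb.le, one_div]

theorem differentiableOn_lerchEulerTail {N : ℕ} {z v : ℂ} {σ : ℝ} (hz : ‖z‖ ≤ 1) (hv : 1 ≤ v.re)
    (hσ : 1 < σ + N) : DifferentiableOn ℂ (lerchEulerTail N z v) {s : ℂ | σ < s.re} := by
  intro s hs
  have hmem : s ∈ {s : ℂ | σ < s.re} ∩ Metric.ball 0 (‖s‖ + 1) :=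
    ⟨hs, mem_ball_zero_iff.mpr (lt_add_one _)⟩
  refine DifferentiableAt.differentiableWithinAt ?_
  refine DifferentiableOn.differentiableAt ?_
    ((isOpen_re_gt_inter_ball σ (‖s‖ + 1)).mem_nhds hmem)
  refine differentiableOn_tsum_of_summable_norm
    (summable_const_mul_natCast_add_rpow _ zero_lt_one hσ) (fun k => ?_)
    (isOpen_re_gt_inter_ball _ _)
    fun k w hw => norm_pow_mul_cpowNegDiff_le hz le_rfl hv hσ hw.1 hw.2 k
  refine ((differentiable_cpowNegDiff N ?_).const_mul _).differentiableOn
  rw [add_natCast_re]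
  positivity

theorem summable_pow_mul_cpow_neg {z v s : ℂ} (hz : ‖z‖ ≤ 1) (hv : 1 ≤ v.re) (hs : 1 < s.re) :
    Summable fun k : ℕ => z ^ k * (v + k) ^ (-s) := by
  obtain ⟨σ, hσ, hσs⟩ := exists_between hs
  have hσ0 : 1 < σ + (0 : ℕ) := by simpa using hσ
  exact (summable_const_mul_natCast_add_rpow _ zero_lt_one hσ0).of_norm_bounded
    fun k => norm_pow_mul_cpowNegDiff_le hz le_rfl hv hσ0 hσs
      (mem_ball_zero_iff.mpr (lt_add_one ‖s‖)) k

theorem isLerchContinuation_lerchEuler {N : ℕ} {z v : ℂ} {σ : ℝ} (hz : ‖z‖ ≤ 1) (hz1 : z ≠ 1)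
    (hv : 1 ≤ v.re) (hσ : 1 < σ + N) : IsLerchContinuation z v σ (lerchEuler N z v) where
  differentiableOn := by
    refine .add (Differentiable.differentiableOn ?_)
      ((differentiableOn_lerchEulerTail hz hv hσ).div_const _)
    exact .fun_sum fun i _ => (differentiable_cpowNegDiff i (by linarith)).const_mul _
  hasSum s _ hs := by
    have hsum := (summable_pow_mul_cpow_neg hz hv hs).hasSum
    convert hsum
    have hEuler := (hasSum_pow_mul_fwdDiff_iterate hz1 hsum N).tsum_eq
    have h0 (i : ℕ) := fwdDiff_iterate_cpow_neg_add_natCast i s v 0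
    simp only [Nat.cast_zero, add_zero] at h0
    simp only [fwdDiff_iterate_cpow_neg_add_natCast, h0] at hEuler
    have hz' : 1 - z ≠ 0 := sub_ne_zero.mpr hz1.symm
    rw [lerchEuler, lerchEulerTail, hEuler]
    field_simp [hz']
    ring

theorem add_natCast_ne_neg_natCast {v : ℂ} (hv : ∀ k : ℕ, v ≠ -(k : ℂ)) (m : ℕ) :
    ∀ k : ℕ, v + m ≠ -(k : ℂ) := fun k h =>
  hv (k + m) (by push_cast; linear_combination h)

theorem add_natCast_ne_zero {v : ℂ} (hv : ∀ k : ℕ, v ≠ -(k : ℂ)) (m : ℕ) : v + m ≠ 0 := by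
  simpa using add_natCast_ne_neg_natCast hv m 0

theorem ne_neg_natCast_of_re_pos {v : ℂ} (hv : 0 < v.re) (k : ℕ) : v ≠ -(k : ℂ) := by
  rintro rfl
  rw [neg_re, natCast_re] at hv
  linarith [k.cast_nonneg (α := ℝ)]

theorem add_one_ne_neg_natCast {v : ℂ} (hv : ∀ k : ℕ, v ≠ -(k : ℂ)) (k : ℕ) : v + 1 ≠ -(k : ℂ) := by
  simpa using add_natCast_ne_neg_natCast hv 1 k

theorem induction_of_one_le_re {P : (v : ℂ) → (∀ k : ℕ, v ≠ -(k : ℂ)) → Prop}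
    (base : ∀ (v : ℂ) (hv : 1 ≤ v.re),
      P v (ne_neg_natCast_of_re_pos (zero_lt_one.trans_le hv)))
    (step : ∀ (v : ℂ) (hv : ∀ k : ℕ, v ≠ -(k : ℂ)),
      P (v + 1) (add_one_ne_neg_natCast hv) → P v hv)
    (v : ℂ) (hv : ∀ k : ℕ, v ≠ -(k : ℂ)) : P v hv := by
  obtain ⟨m, hm⟩ := exists_nat_ge (1 - v.re)
  induction m generalizing v with
  | zero => exact base v (by rw [Nat.cast_zero] at hm; linarith)
  | succ m ih =>
    refine step v hv (ih _ _ ?_)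
    push_cast at hm
    rw [add_re, one_re]
    linarith

theorem IsLerchContinuation.of_add_one {z v : ℂ} {σ : ℝ} {F : ℂ → ℂ} (hv : v ≠ 0)
    (hF : IsLerchContinuation z (v + 1) σ F) :
    IsLerchContinuation z v σ fun s => v ^ (-s) + z * F s where
  differentiableOn := (differentiable_const_cpow_neg hv).differentiableOn.add
    (hF.differentiableOn.const_mul z)
  hasSum s hσ hs := by
    have htail : HasSum (fun k : ℕ => z ^ (k + 1) * (v + (k + 1 : ℕ)) ^ (-s)) (z * F s) := by
      refine ((hF.hasSum s hσ hs).mul_left z).congr_fun fun k => ?_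
      rw [Nat.cast_succ, add_comm (k : ℂ), ← add_assoc, pow_succ', mul_assoc]
    rw [← hasSum_nat_add_iff' 1]
    simpa using htail

theorem exists_isLerchContinuation {z v : ℂ} (hz : ‖z‖ ≤ 1) (hz1 : z ≠ 1)
    (hv : ∀ k : ℕ, v ≠ -(k : ℂ)) (σ : ℝ) : ∃ F, IsLerchContinuation z v σ F := by
  induction v, hv using induction_of_one_le_re with
  | base v hv =>
    obtain ⟨N, hN⟩ := exists_nat_gt (1 - σ)
    exact ⟨_, isLerchContinuation_lerchEuler (N := N) hz hz1 hv (by linarith)⟩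
  | step v hv ih =>
    obtain ⟨F, hF⟩ := ih
    exact ⟨_, hF.of_add_one (by simpa using hv 0)⟩

theorem differentiable_lerchPhi {z v : ℂ} (hz : ‖z‖ ≤ 1) (hz1 : z ≠ 1)
    (hv : ∀ k : ℕ, v ≠ -(k : ℂ)) : Differentiable ℂ fun s => lerchPhi z s v := by
  intro s
  obtain ⟨F, hF⟩ := exists_isLerchContinuation hz hz1 hv (s.re - 1)
  have hmem : {w : ℂ | s.re - 1 < w.re} ∈ 𝓝 s :=
    (isOpen_lt continuous_const continuous_re).mem_nhds (sub_one_lt s.re)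
  refine (hF.differentiableOn.differentiableAt hmem).congr_of_eventuallyEq ?_
  filter_upwards [hmem] with w hw using hF.lerchPhi_eq hw

theorem hasDerivAt_lerchPhi {z v : ℂ} (hz : ‖z‖ ≤ 1) (hz1 : z ≠ 1)
    (hv : ∀ k : ℕ, v ≠ -(k : ℂ)) (s : ℂ) :
    HasDerivAt (fun w => lerchPhi z w v) (lerchPhiDeriv z s v) s :=
  (differentiable_lerchPhi hz hz1 hv s).hasDerivAt

theorem hasSum_lerchPhi {z v s : ℂ} (hz : ‖z‖ ≤ 1) (hz1 : z ≠ 1)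
    (hv : ∀ k : ℕ, v ≠ -(k : ℂ)) (hs : 1 < s.re) :
    HasSum (fun k : ℕ => z ^ k * (v + k) ^ (-s)) (lerchPhi z s v) := by
  obtain ⟨F, hF⟩ := exists_isLerchContinuation hz hz1 hv 1
  rw [hF.lerchPhi_eq hs]
  exact hF.hasSum s hs hs

theorem lerchPhi_eq_lerchEuler {N : ℕ} {z v s : ℂ} (hz : ‖z‖ ≤ 1) (hz1 : z ≠ 1)
    (hv : 1 ≤ v.re) (hs : 1 < s.re + N) : lerchPhi z s v = lerchEuler N z v s := by
  obtain ⟨σ, hσ, hσs⟩ := exists_between (show 1 - N < s.re by linarith)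
  exact (isLerchContinuation_lerchEuler hz hz1 hv (by linarith)).lerchPhi_eq hσs

theorem lerchPhi_eq_add_one {z v : ℂ} (hz : ‖z‖ ≤ 1) (hz1 : z ≠ 1)
    (hv : ∀ k : ℕ, v ≠ -(k : ℂ)) (s : ℂ) :
    lerchPhi z s v = v ^ (-s) + z * lerchPhi z s (v + 1) := by
  obtain ⟨F, hF⟩ := exists_isLerchContinuation hz hz1 (add_one_ne_neg_natCast hv) (s.re - 1)
  have hs : s.re - 1 < s.re := sub_one_lt _
  rw [hF.lerchPhi_eq hs, (hF.of_add_one (by simpa using hv 0)).lerchPhi_eq hs]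

theorem lerchPhiDeriv_zero_eq_add_one {z v : ℂ} (hz : ‖z‖ ≤ 1) (hz1 : z ≠ 1)
    (hv : ∀ k : ℕ, v ≠ -(k : ℂ)) :
    lerchPhiDeriv z 0 v = -log v + z * lerchPhiDeriv z 0 (v + 1) := by
  have hv0 : v ≠ 0 := by simpa using hv 0
  have hpow := (hasDerivAt_neg (0 : ℂ)).const_cpow (.inl hv0)
  rw [lerchPhiDeriv, funext (lerchPhi_eq_add_one hz hz1 hv),
    (hpow.fun_add ((hasDerivAt_lerchPhi hz hz1 (add_one_ne_neg_natCast hv) 0).const_mul z)).deriv]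
  simp

theorem cpowNegDiff_succ_zero_left (N : ℕ) (u : ℂ) : cpowNegDiff (N + 1) 0 u = 0 := by
  induction N generalizing u with
  | zero => simp [cpowNegDiff_succ, cpowNegDiff_zero]
  | succ N ih => rw [cpowNegDiff_succ, ih, ih, sub_zero]

theorem lerchPhi_zero {z v : ℂ} (hz : ‖z‖ ≤ 1) (hz1 : z ≠ 1) (hv : ∀ k : ℕ, v ≠ -(k : ℂ)) :
    lerchPhi z 0 v = (1 - z)⁻¹ := by
  induction v, hv using induction_of_one_le_re with
  | base v hv =>
    rw [lerchPhi_eq_lerchEuler (N := 2) hz hz1 hv (by norm_num), lerchEuler, lerchEulerTail]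
    simp [Finset.sum_range_succ, cpowNegDiff_succ_zero_left, cpowNegDiff_zero]
  | step v hv ih =>
    rw [lerchPhi_eq_add_one hz hz1 hv, ih, neg_zero, cpow_zero]
    field_simp [sub_ne_zero.mpr hz1.symm]
    ring

theorem eq_of_differentiable_of_re_gt {E : Type*} [NormedAddCommGroup E] [NormedSpace ℂ E]
    [CompleteSpace E] {f g : ℂ → E} (hf : Differentiable ℂ f) (hg : Differentiable ℂ g) {c : ℝ}
    (h : ∀ s : ℂ, c < s.re → f s = g s) : f = g := by
  refine AnalyticOnNhd.eq_of_eventuallyEq (z₀ := (c + 1 : ℝ)) (fun s _ => hf.analyticAt s)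
    (fun s _ => hg.analyticAt s) ?_
  filter_upwards [(isOpen_lt continuous_const continuous_re).mem_nhds
    (show c < ((c + 1 : ℝ) : ℂ).re by simp)] with s hs using h s hs

theorem norm_lerchEulerTail_le {N : ℕ} {z v s : ℂ} {σ b R : ℝ} (hz : ‖z‖ ≤ 1) (hb : 1 ≤ b)
    (hv : b ≤ v.re) (hσ : 1 < σ + N) (hs : σ < s.re) (hR : s ∈ Metric.ball 0 R) :
    ‖lerchEulerTail N z v s‖ ≤
      Real.exp (Real.pi * (R + N)) * (R + N) ^ N * ∑' k : ℕ, ((k : ℝ) + b) ^ (-(σ + N)) := by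
  rw [← tsum_mul_left]
  exact tsum_of_norm_bounded
    (summable_const_mul_natCast_add_rpow _ (zero_lt_one.trans_le hb) hσ).hasSum
    (norm_pow_mul_cpowNegDiff_le hz hb hv hσ hs hR)

theorem norm_lerchPhi_sub_le {z v s : ℂ} {σ b R : ℝ} (hz : ‖z‖ ≤ 1) (hz1 : z ≠ 1) (hb : 1 ≤ b)
    (hv : b ≤ v.re) (hσ : -1 < σ) (hs : σ < s.re) (hR : s ∈ Metric.ball 0 R) :
    ‖lerchPhi z s v - v ^ (-s) / (1 - z)‖ ≤
      (Real.exp (Real.pi * (R + 1)) * (R + 1) * b ^ (-(σ + 1)) +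
        Real.exp (Real.pi * (R + 2)) * (R + 2) ^ 2 * ∑' k : ℕ, ((k : ℝ) + b) ^ (-(σ + 2))) /
      ‖1 - z‖ ^ 2 := by
  have hsR : ‖s‖ < R := mem_ball_zero_iff.mp hR
  have hz' : 1 - z ≠ 0 := sub_ne_zero.mpr hz1.symm
  have hdiff : ‖z * cpowNegDiff 1 s v‖ ≤
      Real.exp (Real.pi * (R + 1)) * (R + 1) * b ^ (-(σ + 1)) := by
    rw [norm_mul]
    refine (mul_le_of_le_one_left (norm_nonneg _) hz).trans ?_
    simpa using norm_cpowNegDiff_le (N := 1) (R := R + 1) hb hv (by push_cast; linarith) hs.le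
      (by push_cast; linarith)
  have htail : ‖lerchEulerTail 2 z v s‖ ≤
      Real.exp (Real.pi * (R + 2)) * (R + 2) ^ 2 * ∑' k : ℕ, ((k : ℝ) + b) ^ (-(σ + 2)) := by
    simpa using norm_lerchEulerTail_le (N := 2) hz hb hv (by push_cast; linarith) hs hR
  have hexpand : lerchPhi z s v - v ^ (-s) / (1 - z) =
      (z * cpowNegDiff 1 s v + lerchEulerTail 2 z v s) / (1 - z) ^ 2 := by
    rw [lerchPhi_eq_lerchEuler (N := 2) hz hz1 (hb.trans hv) (by push_cast; linarith), lerchEuler,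
      Finset.sum_range_succ, Finset.sum_range_one, cpowNegDiff_zero]
    field_simp
    ring
  rw [hexpand, norm_div, norm_pow]
  gcongr
  exact (norm_add_le _ _).trans (add_le_add hdiff htail)

theorem tendsto_tsum_natCast_add_rpow (p : ℝ) :
    Tendsto (fun m : ℕ => ∑' k : ℕ, ((k : ℝ) + (m + 1)) ^ (-p)) atTop (𝓝 0) := by
  refine (tendsto_sum_nat_add fun k : ℕ => ((k : ℝ) + 1) ^ (-p)).congr fun m => ?_
  push_cast
  simp only [add_assoc]

theorem tendstoUniformlyOn_lerchPhi_sub {z v : ℂ} {σ : ℝ} (hz : ‖z‖ ≤ 1) (hz1 : z ≠ 1)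
    (hv : 1 ≤ v.re) (hσ : -1 < σ) (R : ℝ) :
    TendstoUniformlyOn (fun (m : ℕ) s => lerchPhi z s (v + m) - (v + m) ^ (-s) / (1 - z)) 0 atTop
      ({s : ℂ | σ < s.re} ∩ Metric.ball 0 R) := by
  have hnat : Tendsto (fun m : ℕ => (m : ℝ) + 1) atTop atTop :=
    tendsto_atTop_add_const_right _ _ tendsto_natCast_atTop_atTop
  have hpow : Tendsto (fun m : ℕ => ((m : ℝ) + 1) ^ (-(σ + 1))) atTop (𝓝 0) :=
    (tendsto_rpow_neg_atTop (by linarith)).comp hnat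
  have hmajorant : Tendsto (fun m : ℕ => (Real.exp (Real.pi * (R + 1)) * (R + 1) *
      ((m : ℝ) + 1) ^ (-(σ + 1)) + Real.exp (Real.pi * (R + 2)) * (R + 2) ^ 2 *
        ∑' k : ℕ, ((k : ℝ) + (m + 1)) ^ (-(σ + 2))) / ‖1 - z‖ ^ 2) atTop (𝓝 0) := by
    have h := ((hpow.const_mul (Real.exp (Real.pi * (R + 1)) * (R + 1))).add
      ((tendsto_tsum_natCast_add_rpow (σ + 2)).const_mul
        (Real.exp (Real.pi * (R + 2)) * (R + 2) ^ 2))).div_const (‖1 - z‖ ^ 2)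
    rwa [mul_zero, mul_zero, add_zero, zero_div] at h
  rw [Metric.tendstoUniformlyOn_iff]
  intro ε hε
  filter_upwards [hmajorant.eventually_lt_const hε] with m hm s hs
  rw [Pi.zero_apply, dist_zero_left]
  refine (norm_lerchPhi_sub_le hz hz1 (by linarith [m.cast_nonneg (α := ℝ)]) ?_ hσ hs.1 hs.2
    ).trans_lt hm
  rw [add_natCast_re]
  linarith

theorem tendsto_lerchPhiDeriv_zero_add_log {z v : ℂ} (hz : ‖z‖ ≤ 1) (hz1 : z ≠ 1)
    (hv : ∀ k : ℕ, v ≠ -(k : ℂ)) :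
    Tendsto (fun m : ℕ => lerchPhiDeriv z 0 (v + m) + log (v + m) / (1 - z)) atTop (𝓝 0) := by
  induction v, hv using induction_of_one_le_re with
  | base v hv =>
    have hv' := ne_neg_natCast_of_re_pos (zero_lt_one.trans_le hv)
    have hderiv (m : ℕ) (s : ℂ) :=
      (hasDerivAt_lerchPhi hz hz1 (add_natCast_ne_neg_natCast hv' m) s).fun_sub
        (((hasDerivAt_neg s).const_cpow (.inl (add_natCast_ne_zero hv' m))).div_const (1 - z))
    have hlim := (tendstoUniformlyOn_lerchPhi_sub (σ := -(1 / 2)) hz hz1 hv (by norm_num)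
      1).tendstoLocallyUniformlyOn.deriv
      (.of_forall fun m s _ => (hderiv m s).differentiableAt.differentiableWithinAt)
      (isOpen_re_gt_inter_ball _ _)
    have hlim0 := hlim.tendsto_at (a := 0) (by simp)
    have hzero : deriv (0 : ℂ → ℂ) 0 = 0 := deriv_const 0 0
    rw [hzero] at hlim0
    refine hlim0.congr fun m => ?_
    rw [Function.comp_apply, (hderiv m 0).deriv]
    simp [neg_div]
  | step v _ ih =>
    refine (tendsto_add_atTop_iff_nat 1).mp (ih.congr fun m => ?_)
    rw [Nat.cast_add, Nat.cast_one, add_comm (m : ℂ), add_assoc]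

theorem Gamma_add_natCast_add_one {a : ℂ} (ha : ∀ k : ℕ, a ≠ -(k : ℂ)) (m : ℕ) :
    Gamma (a + m + 1) = Gamma a * ∏ j ∈ Finset.range (m + 1), (a + j) := by
  induction m with
  | zero => simp [Gamma_add_one a (by simpa using ha 0), mul_comm]
  | succ m ih =>
    rw [Finset.prod_range_succ, ← mul_assoc, ← ih, Gamma_add_one _ (add_natCast_ne_zero ha _),
      mul_comm, Nat.cast_succ, add_assoc a]

theorem tendsto_Gamma_add_natCast_div {a : ℂ} (ha : ∀ k : ℕ, a ≠ -(k : ℂ)) :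
    Tendsto (fun m : ℕ => Gamma (a + m + 1) / ((m : ℂ) ^ a * m.factorial)) atTop (𝓝 1) := by
  have hlim := tendsto_const_nhds (x := Gamma a) |>.div
    (GammaSeq_tendsto_Gamma a) (Gamma_ne_zero ha)
  rw [div_self (Gamma_ne_zero ha)] at hlim
  refine hlim.congr fun m => ?_
  rw [Pi.div_apply, Gamma_add_natCast_add_one ha, GammaSeq, div_div_eq_mul_div]

theorem tendsto_Gamma_add_natCast_div_Gamma_add_natCast {a b : ℂ} (ha : ∀ k : ℕ, a ≠ -(k : ℂ))
    (hb : ∀ k : ℕ, b ≠ -(k : ℂ)) :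
    Tendsto (fun m : ℕ => Gamma (b + m + 1) / Gamma (a + m + 1) / (m : ℂ) ^ (b - a)) atTop
      (𝓝 1) := by
  have hlim := (tendsto_Gamma_add_natCast_div hb).div (tendsto_Gamma_add_natCast_div ha) one_ne_zero
  rw [div_one] at hlim
  refine hlim.congr' ?_
  filter_upwards [eventually_ne_atTop 0] with m hm
  have hm' : (m : ℂ) ≠ 0 := Nat.cast_ne_zero.mpr hm
  have hfact : (m.factorial : ℂ) ≠ 0 := Nat.cast_ne_zero.mpr m.factorial_ne_zero
  rw [Pi.div_apply, cpow_sub _ _ hm', mul_comm, mul_comm ((m : ℂ) ^ a), div_div_div_eq]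
  field_simp

theorem tendsto_log_mul_natCast_add_sub_log {b : ℂ} (hb : b ∈ slitPlane) (c : ℂ) :
    Tendsto (fun m : ℕ => log (b * m + c) - log m) atTop (𝓝 (log b)) := by
  have hdiv : Tendsto (fun m : ℕ => b + c / m) atTop (𝓝 b) := by
    simpa using tendsto_const_nhds.add (tendsto_const_div_atTop_nhds_zero_nat c)
  refine ((continuousAt_clog hb).tendsto.comp hdiv).congr' ?_
  filter_upwards [eventually_gt_atTop 0, hdiv.eventually_ne (slitPlane_ne_zero hb)] with m hm hne
  have hm' : (m : ℂ) ≠ 0 := Nat.cast_ne_zero.mpr hm.ne'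
  have hfactor : b * m + c = (m : ℝ) * (b + c / m) := by
    push_cast
    field_simp
  rw [Function.comp_apply, hfactor, log_ofReal_mul (Nat.cast_pos.mpr hm) hne, natCast_log.symm]
  ring

theorem exp_neg_log_ofReal_div_two {r : ℝ} (hr : 0 < r) : exp (-(log r / 2)) = 1 / (√r : ℂ) := by
  rw [exp_neg, ← ofReal_log hr.le, one_div, Real.sqrt_eq_rpow, Real.rpow_def_of_pos hr]
  push_cast
  ring_nf

/-- `exp ∘ Φ'(-1, 0, ·)` divided by the quotient of Gamma values that it is proportional to. -/
noncomputable def lerchGammaRatio (y : ℂ) : ℂ :=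
  Gamma ((y + 1) / 2) / Gamma (y / 2) * exp (lerchPhiDeriv (-1) 0 y)

theorem div_natCast_ne_neg_natCast {y : ℂ} {d : ℕ} (hd : d ≠ 0) (hy : ∀ k : ℕ, y ≠ -(k : ℂ))
    (k : ℕ) : y / d ≠ -(k : ℂ) := fun h => by
  have hd' : (d : ℂ) ≠ 0 := Nat.cast_ne_zero.mpr hd
  refine hy (k * d) ?_
  rw [div_eq_iff hd'] at h
  rw [h]
  push_cast
  ring

theorem lerchGammaRatio_add_two {y : ℂ} (hy : ∀ k : ℕ, y ≠ -(k : ℂ)) :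
    lerchGammaRatio (y + 2) = lerchGammaRatio y := by
  have hone : (-1 : ℂ) ≠ 1 := by norm_num
  have hy0 : y ≠ 0 := by simpa using hy 0
  have hy1 : y + 1 ≠ 0 := by simpa using add_natCast_ne_zero hy 1
  have hderiv : lerchPhiDeriv (-1) 0 y =
      -log y + log (y + 1) + lerchPhiDeriv (-1) 0 (y + 2) := by
    rw [lerchPhiDeriv_zero_eq_add_one (by simp) hone hy, lerchPhiDeriv_zero_eq_add_one (by simp)
      hone (add_one_ne_neg_natCast hy), add_assoc y, one_add_one_eq_two]
    ring
  have hΓ : Gamma (y / 2) ≠ 0 :=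
    Gamma_ne_zero (by simpa using div_natCast_ne_neg_natCast two_ne_zero hy)
  rw [lerchGammaRatio, lerchGammaRatio, hderiv, exp_add, exp_add, exp_neg, exp_log hy0,
    exp_log hy1, show (y + 2 + 1) / 2 = (y + 1) / 2 + 1 by ring,
    show (y + 2) / 2 = y / 2 + 1 by ring, Gamma_add_one _ (div_ne_zero hy1 two_ne_zero),
    Gamma_add_one _ (div_ne_zero hy0 two_ne_zero)]
  field_simp

theorem lerchGammaRatio_add_two_mul {y : ℂ} (hy : ∀ k : ℕ, y ≠ -(k : ℂ)) (m : ℕ) :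
    lerchGammaRatio (y + 2 * m) = lerchGammaRatio y := by
  induction m with
  | zero => simp
  | succ m ih =>
    have h := add_natCast_ne_neg_natCast hy (2 * m)
    push_cast at h ⊢
    rw [mul_add, mul_one, ← add_assoc, lerchGammaRatio_add_two h, ih]

theorem tendsto_exp_lerchPhiDeriv_neg_one_mul_cpow {y : ℂ} (hy : ∀ k : ℕ, y ≠ -(k : ℂ)) :
    Tendsto (fun m : ℕ => exp (lerchPhiDeriv (-1) 0 (y + 2 * (m + 1 : ℕ))) * (m : ℂ) ^ (1 / 2 : ℂ))
      atTop (𝓝 (1 / (√2 : ℂ))) := by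
  have heven : Tendsto (fun m : ℕ => 2 * (m + 1)) atTop atTop :=
    (tendsto_add_atTop_nat 1).const_mul_atTop' two_pos
  have hderiv :=
    (tendsto_lerchPhiDeriv_zero_add_log (z := -1) (by simp) (by norm_num) hy).comp heven
  have hlog := (tendsto_log_mul_natCast_add_sub_log (b := 2) (by simp) (y + 2)).div_const 2
  have hlim := (hderiv.sub hlog).cexp
  have hsqrt := exp_neg_log_ofReal_div_two two_pos
  rw [ofReal_ofNat] at hsqrt
  rw [zero_sub, hsqrt] at hlim
  refine hlim.congr' ?_
  filter_upwards [eventually_ne_atTop 0] with m hm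
  rw [cpow_def_of_ne_zero (Nat.cast_ne_zero.mpr hm), ← exp_add, Function.comp_apply]
  push_cast
  rw [show 2 * (m : ℂ) + (y + 2) = y + 2 * (m + 1) by ring]
  congr 1
  ring

theorem tendsto_lerchGammaRatio {y : ℂ} (hy : ∀ k : ℕ, y ≠ -(k : ℂ)) :
    Tendsto (fun m : ℕ => lerchGammaRatio (y + 2 * (m + 1 : ℕ))) atTop (𝓝 (1 / (√2 : ℂ))) := by
  have hΓ := tendsto_Gamma_add_natCast_div_Gamma_add_natCast
    (div_natCast_ne_neg_natCast two_ne_zero hy)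
    (div_natCast_ne_neg_natCast two_ne_zero (add_one_ne_neg_natCast hy))
  have hlim := hΓ.mul (tendsto_exp_lerchPhiDeriv_neg_one_mul_cpow hy)
  rw [one_mul] at hlim
  refine hlim.congr' ?_
  filter_upwards [eventually_ne_atTop 0] with m hm
  have hpow : (m : ℂ) ^ (1 / 2 : ℂ) ≠ 0 := by simp [cpow_eq_zero_iff, hm]
  push_cast
  rw [lerchGammaRatio, show (y + 1) / 2 - y / 2 = 1 / 2 by ring,
    show (y + 2 * ((m : ℂ) + 1) + 1) / 2 = (y + 1) / 2 + m + 1 by ring,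
    show (y + 2 * ((m : ℂ) + 1)) / 2 = y / 2 + m + 1 by ring]
  field_simp

theorem exp_lerchPhiDeriv_neg_one_zero {y : ℂ} (hy : ∀ k : ℕ, y ≠ -(k : ℂ)) :
    exp (lerchPhiDeriv (-1) 0 y) = 1 / (√2 : ℂ) * (Gamma (y / 2) / Gamma ((y + 1) / 2)) := by
  have hlim := tendsto_lerchGammaRatio hy
  simp only [lerchGammaRatio_add_two_mul hy] at hlim
  rw [← tendsto_nhds_unique tendsto_const_nhds hlim, lerchGammaRatio]
  have ha := Gamma_ne_zero (div_natCast_ne_neg_natCast two_ne_zero hy)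
  have hb := Gamma_ne_zero (div_natCast_ne_neg_natCast two_ne_zero (add_one_ne_neg_natCast hy))
  rw [Nat.cast_ofNat] at ha hb
  field_simp

theorem ofReal_mul_cpow {r : ℝ} (hr : 0 < r) (w s : ℂ) : (r * w) ^ s = (r : ℂ) ^ s * w ^ s := by
  have hr' : (r : ℂ) ≠ 0 := ofReal_ne_zero.mpr hr.ne'
  rcases eq_or_ne w 0 with rfl | hw
  · rcases eq_or_ne s 0 with rfl | hs
    · simp
    · simp [zero_cpow hs]
  · rw [cpow_def_of_ne_zero hr', cpow_def_of_ne_zero (mul_ne_zero hr' hw), cpow_def_of_ne_zero hw,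
      log_ofReal_mul hr hw, ← ofReal_log hr.le, ← exp_add, add_mul]

theorem sum_inv_pow_mul_pow_pow {K : Type*} [Field K] {ζ : K} {M : ℕ}
    (hζ : IsPrimitiveRoot ζ M) (r k : ℕ) :
    ∑ j ∈ Finset.range M, ((ζ ^ r)⁻¹) ^ j * (ζ ^ j) ^ k = if k ≡ r [MOD M] then (M : K) else 0 := by
  rcases eq_or_ne M 0 with rfl | hM
  · simp
  have hterm (j : ℕ) : ((ζ ^ r)⁻¹) ^ j * (ζ ^ j) ^ k = ((ζ ^ r)⁻¹ * ζ ^ k) ^ j := by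
    rw [mul_pow, pow_right_comm]
  have hratio : (ζ ^ r)⁻¹ * ζ ^ k = 1 ↔ k ≡ r [MOD M] := by
    rw [inv_mul_eq_one₀ (pow_ne_zero r (hζ.ne_zero hM)), eq_comm,
      (hζ.isOfFinOrder hM).pow_eq_pow_iff_modEq, ← hζ.eq_orderOf]
  simp only [hterm]
  split_ifs with hk
  · simp [hratio.mpr hk]
  · rw [geom_sum_eq (mt hratio.mp hk), mul_pow, inv_pow, pow_right_comm ζ r,
      pow_right_comm ζ k, hζ.pow_eq_one]
    simp

theorem hasSum_ite_modEq_iff {E : Type*} [AddCommMonoid E] [TopologicalSpace E] {M r : ℕ}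
    (hr : r < M) {f : ℕ → E} {S : E} :
    HasSum (fun k => if k ≡ r [MOD M] then f k else 0) S ↔ HasSum (fun m => f (r + M * m)) S := by
  have hinj : Function.Injective fun m : ℕ => r + M * m := fun a b h =>
    Nat.eq_of_mul_eq_mul_left (Nat.zero_lt_of_lt hr) (Nat.add_left_cancel h)
  rw [← hinj.hasSum_iff fun k hk => if_neg fun hmod => hk ⟨k / M, ?_⟩]
  · simp [Function.comp_def, Nat.ModEq]
  · have hk' : k % M = r := Nat.mod_eq_of_modEq hmod hr
    simpa [hk'] using Nat.mod_add_div k M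

section Multisection

variable {M r : ℕ} {ζ z x : ℂ}

theorem norm_pow_le_one (hz : ‖z‖ ≤ 1) (k : ℕ) : ‖z ^ k‖ ≤ 1 :=
  (norm_pow z k).trans_le (pow_le_one₀ (norm_nonneg z) hz)

theorem hasSum_lerchPhi_multisection (hr : r < M) (hz : ‖z‖ ≤ 1) (hzM : z ^ M ≠ 1)
    (hx : ∀ k : ℕ, x ≠ -(k : ℂ)) {s : ℂ} (hs : 1 < s.re) :
    HasSum (fun m : ℕ => M * z ^ (r + M * m) * (x + (r + M * m : ℕ)) ^ (-s))
      ((M : ℂ) ^ (1 - s) * z ^ r * lerchPhi (z ^ M) s ((x + r) / M)) := by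
  have hM : M ≠ 0 := (Nat.zero_lt_of_lt hr).ne'
  have hM' : (M : ℂ) ≠ 0 := Nat.cast_ne_zero.mpr hM
  have hsum := hasSum_lerchPhi (norm_pow_le_one hz M) hzM
    (div_natCast_ne_neg_natCast hM (add_natCast_ne_neg_natCast hx r)) hs
  refine (hsum.mul_left _).congr_fun fun m => ?_
  have hscale : x + (r + M * m : ℕ) = (M : ℝ) * ((x + r) / M + m) := by
    push_cast
    field_simp
    ring
  rw [hscale, ofReal_mul_cpow (Nat.cast_pos.mpr (Nat.zero_lt_of_lt hr)), sub_eq_add_neg,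
    cpow_add _ _ hM', cpow_one, pow_add, pow_mul, ofReal_natCast]
  ring

theorem norm_mul_pow_le_one (hζ : IsPrimitiveRoot ζ M) (hM : M ≠ 0) (hz : ‖z‖ ≤ 1) (j : ℕ) :
    ‖ζ ^ j * z‖ ≤ 1 := by
  rw [norm_mul, norm_pow, hζ.norm'_eq_one hM, one_pow, one_mul]
  exact hz

theorem pow_mul_ne_one (hζ : IsPrimitiveRoot ζ M) (hzM : z ^ M ≠ 1) (j : ℕ) : ζ ^ j * z ≠ 1 := by
  intro h
  have hpow := congrArg (· ^ M) h
  simp only [mul_pow, pow_right_comm ζ j M, hζ.pow_eq_one, one_pow, one_mul] at hpow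
  exact hzM hpow

theorem sum_lerchPhi_multisection_of_one_lt_re (hζ : IsPrimitiveRoot ζ M) (hr : r < M)
    (hz : ‖z‖ ≤ 1) (hzM : z ^ M ≠ 1) (hx : ∀ k : ℕ, x ≠ -(k : ℂ)) {s : ℂ} (hs : 1 < s.re) :
    ∑ j ∈ Finset.range M, ((ζ ^ r)⁻¹) ^ j * lerchPhi (ζ ^ j * z) s x =
      (M : ℂ) ^ (1 - s) * z ^ r * lerchPhi (z ^ M) s ((x + r) / M) := by
  have hM : M ≠ 0 := (Nat.zero_lt_of_lt hr).ne'
  have hsum := hasSum_sum (s := Finset.range M) fun j _ =>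
    (hasSum_lerchPhi (norm_mul_pow_le_one hζ hM hz j) (pow_mul_ne_one hζ hzM j) hx hs).mul_left
      (((ζ ^ r)⁻¹) ^ j)
  have hfilter (k : ℕ) :
      ∑ j ∈ Finset.range M, ((ζ ^ r)⁻¹) ^ j * ((ζ ^ j * z) ^ k * (x + k) ^ (-s)) =
        if k ≡ r [MOD M] then M * z ^ k * (x + k) ^ (-s) else 0 := by
    simp only [mul_pow, ← mul_assoc, ← Finset.sum_mul, sum_inv_pow_mul_pow_pow hζ, ite_mul,
      zero_mul]
  simp only [hfilter] at hsum
  exact ((hasSum_ite_modEq_iff hr).mp hsum).unique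
    (hasSum_lerchPhi_multisection hr hz hzM hx hs)

theorem sum_lerchPhi_multisection (hζ : IsPrimitiveRoot ζ M) (hr : r < M) (hz : ‖z‖ ≤ 1)
    (hzM : z ^ M ≠ 1) (hx : ∀ k : ℕ, x ≠ -(k : ℂ)) (s : ℂ) :
    ∑ j ∈ Finset.range M, ((ζ ^ r)⁻¹) ^ j * lerchPhi (ζ ^ j * z) s x =
      (M : ℂ) ^ (1 - s) * z ^ r * lerchPhi (z ^ M) s ((x + r) / M) := by
  have hM : M ≠ 0 := (Nat.zero_lt_of_lt hr).ne'
  have hlhs : Differentiable ℂ fun s => ∑ j ∈ Finset.range M,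
      ((ζ ^ r)⁻¹) ^ j * lerchPhi (ζ ^ j * z) s x :=
    .fun_sum fun j _ => (differentiable_lerchPhi (norm_mul_pow_le_one hζ hM hz j)
      (pow_mul_ne_one hζ hzM j) hx).const_mul _
  have hrhs : Differentiable ℂ fun s =>
      (M : ℂ) ^ (1 - s) * z ^ r * lerchPhi (z ^ M) s ((x + r) / M) :=
    .fun_mul (.mul_const (.const_cpow (by fun_prop) (.inl (Nat.cast_ne_zero.mpr hM))) _)
      (differentiable_lerchPhi (norm_pow_le_one hz M) hzM
        (div_natCast_ne_neg_natCast hM (add_natCast_ne_neg_natCast hx r)))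
  have heq := eq_of_differentiable_of_re_gt (c := 1) hlhs hrhs
    fun s hs => sum_lerchPhi_multisection_of_one_lt_re hζ hr hz hzM hx hs
  exact congrFun heq s

theorem sum_lerchPhiDeriv_multisection (hζ : IsPrimitiveRoot ζ M) (hr : r < M) (hz : ‖z‖ ≤ 1)
    (hzM : z ^ M ≠ 1) (hx : ∀ k : ℕ, x ≠ -(k : ℂ)) :
    ∑ j ∈ Finset.range M, ((ζ ^ r)⁻¹) ^ j * lerchPhiDeriv (ζ ^ j * z) 0 x =
      M * z ^ r * (lerchPhiDeriv (z ^ M) 0 ((x + r) / M) - log M / (1 - z ^ M)) := by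
  have hM : M ≠ 0 := (Nat.zero_lt_of_lt hr).ne'
  have hM' : (M : ℂ) ≠ 0 := Nat.cast_ne_zero.mpr hM
  have hxM := div_natCast_ne_neg_natCast hM (add_natCast_ne_neg_natCast hx r)
  have hlhs := HasDerivAt.fun_sum (u := Finset.range M) fun j _ =>
    (hasDerivAt_lerchPhi (norm_mul_pow_le_one hζ hM hz j) (pow_mul_ne_one hζ hzM j) hx 0).const_mul
      (((ζ ^ r)⁻¹) ^ j)
  have hrhs := (((hasDerivAt_id (0 : ℂ)).const_sub 1).const_cpow (.inl hM')).mul_const (z ^ r)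
    |>.mul (hasDerivAt_lerchPhi (norm_pow_le_one hz M) hzM hxM 0)
  have hderiv := hlhs.unique (hrhs.congr_of_eventuallyEq
    (.of_forall fun s => sum_lerchPhi_multisection hζ hr hz hzM hx s))
  rw [hderiv, lerchPhi_zero (norm_pow_le_one hz M) hzM hxM]
  simp only [id_eq, sub_zero, cpow_one]
  ring

end Multisection

theorem two_mul_natCast_add_one_ne_zero (n : ℕ) : (2 * n + 1 : ℂ) ≠ 0 := by
  exact_mod_cast (2 * n).succ_ne_zero

theorem neg_exp_eq_pow_mul_neg_one (n j : ℕ) :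
    -exp (2 * I * Real.pi * j / (2 * n + 1)) =
      exp (2 * Real.pi * I / (2 * n + 1 : ℕ)) ^ j * -1 := by
  rw [mul_neg_one, ← exp_nat_mul]
  congr 2
  push_cast
  ring

theorem neg_one_zpow_sub_mul_exp (n j : ℕ) :
    (-1 : ℂ) ^ ((j : ℤ) - n) * exp (I * Real.pi * j / (2 * n + 1)) =
      (-1) ^ n * ((exp (2 * Real.pi * I / (2 * n + 1 : ℕ)) ^ n)⁻¹) ^ j := by
  have hN := two_mul_natCast_add_one_ne_zero n
  have hsign : (-1 : ℂ) ^ ((j : ℤ) - n) = (-1) ^ n * (-1) ^ j := by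
    rw [zpow_sub₀ (by norm_num), zpow_natCast, zpow_natCast, div_eq_mul_inv, ← inv_pow, inv_neg_one,
      mul_comm]
  have hphase : (-1) ^ j * exp (I * Real.pi * j / (2 * n + 1)) =
      ((exp (2 * Real.pi * I / (2 * n + 1 : ℕ)) ^ n)⁻¹) ^ j := by
    rw [← exp_neg_pi_mul_I]
    simp only [← exp_nat_mul, ← exp_neg, ← exp_add]
    congr 1
    push_cast
    field_simp
    ring
  rw [hsign, mul_assoc, hphase]

section Product

variable {n : ℕ} {x : ℂ}

theorem neg_one_pow_two_mul_add_one_ne_one (n : ℕ) : (-1 : ℂ) ^ (2 * n + 1) ≠ 1 := by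
  rw [(odd_two_mul_add_one n).neg_one_pow]
  norm_num

theorem differentiable_lerchPhi_neg_exp (hx : ∀ k : ℕ, x ≠ -(k : ℂ)) (j : ℕ) :
    Differentiable ℂ fun s => lerchPhi (-exp (2 * I * Real.pi * j / (2 * n + 1))) s x := by
  have hζ := isPrimitiveRoot_exp (2 * n + 1) (2 * n).succ_ne_zero
  rw [neg_exp_eq_pow_mul_neg_one]
  exact differentiable_lerchPhi (norm_mul_pow_le_one hζ (2 * n).succ_ne_zero (by simp) j)
    (pow_mul_ne_one hζ (neg_one_pow_two_mul_add_one_ne_one n) j) hx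

theorem lerchExpProduct_eq_exp (hx : ∀ k : ℕ, x ≠ -(k : ℂ)) :
    lerchExpProduct n x =
      exp (lerchPhiDeriv (-1) 0 ((x + n) / (2 * n + 1 : ℕ)) - log (2 * n + 1 : ℕ) / 2) := by
  have hN := two_mul_natCast_add_one_ne_zero n
  have hsum := sum_lerchPhiDeriv_multisection (isPrimitiveRoot_exp (2 * n + 1)
    (2 * n).succ_ne_zero) (show n < 2 * n + 1 by omega) (by simp)
    (neg_one_pow_two_mul_add_one_ne_one n) hx
  have hsign : ((-1 : ℂ) ^ n) * (-1) ^ n = 1 := by rw [← mul_pow]; norm_num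
  rw [(odd_two_mul_add_one n).neg_one_pow, sub_neg_eq_add, one_add_one_eq_two] at hsum
  rw [lerchExpProduct, ← exp_sum, ← Finset.sum_div]
  congr 1
  simp only [neg_exp_eq_pow_mul_neg_one, neg_one_zpow_sub_mul_exp, mul_assoc ((-1 : ℂ) ^ n),
    ← Finset.mul_sum]
  rw [hsum, ← mul_assoc, mul_left_comm, hsign]
  push_cast
  field_simp

theorem lerchExpProduct_eq_Gamma_div (hx : ∀ k : ℕ, x ≠ -(k : ℂ)) :
    lerchExpProduct n x = 1 / (√(2 * (1 + 2 * n)) : ℂ) *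
      (Gamma ((n + x) / (2 + 4 * n)) / Gamma ((1 + 3 * n + x) / (2 + 4 * n))) := by
  have hN := two_mul_natCast_add_one_ne_zero n
  have hden : (2 + 4 * n : ℂ) = (2 * n + 1) * 2 := by ring
  have hy := div_natCast_ne_neg_natCast (2 * n).succ_ne_zero (add_natCast_ne_neg_natCast hx n)
  have hscale : exp (-(log (2 * n + 1 : ℕ) / 2)) = 1 / (√(1 + 2 * n) : ℂ) := by
    have h := exp_neg_log_ofReal_div_two (r := 1 + 2 * n) (by positivity)
    rw [← h]
    push_cast
    rw [add_comm]
  have hleft : (x + n) / (2 * n + 1 : ℕ) / 2 = (n + x) / (2 + 4 * n) := by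
    rw [hden, div_div, add_comm x]
    push_cast
    rfl
  have hright : ((x + n) / (2 * n + 1 : ℕ) + 1) / 2 = (1 + 3 * n + x) / (2 + 4 * n) := by
    push_cast
    rw [hden, div_add_one hN, div_div]
    congr 1
    ring
  rw [lerchExpProduct_eq_exp hx, sub_eq_add_neg, exp_add, exp_lerchPhiDeriv_neg_one_zero hy,
    hscale, hleft, hright, Real.sqrt_mul zero_le_two, ofReal_mul]
  ring

end Product

theorem image_one_sub_inv_one_add_Ioi :
    (fun z : ℝ => 1 - (1 + z)⁻¹) '' Set.Ioi 0 = Set.Ioo 0 1 := by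
  ext t
  constructor
  · rintro ⟨z, hz : 0 < z, rfl⟩
    exact ⟨sub_pos.mpr (inv_lt_one_of_one_lt₀ (lt_add_of_pos_right 1 hz)),
      sub_lt_self 1 (by positivity)⟩
  · rintro ⟨ht0, ht1⟩
    exact ⟨(1 - t)⁻¹ - 1, sub_pos.mpr ((one_lt_inv₀ (sub_pos.mpr ht1)).mpr (sub_lt_self 1 ht0)),
      by simp⟩

theorem abs_smul_betaIntegrand_one_sub_inv_one_add {u v : ℂ} {z : ℝ} (hz : 0 < z) :
    |((1 + z) ^ 2)⁻¹| • (((1 - (1 + z)⁻¹ : ℝ) : ℂ) ^ (u - 1) *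
      (1 - ((1 - (1 + z)⁻¹ : ℝ) : ℂ)) ^ (v - 1)) = (z : ℂ) ^ (u - 1) / ((z : ℂ) + 1) ^ (u + v) := by
  have hpos : 0 < 1 + z := by linarith
  have hne : ((1 + z : ℝ) : ℂ) ≠ 0 := ofReal_ne_zero.mpr hpos.ne'
  have hleft : (1 - (1 + z)⁻¹ : ℝ) = z * (1 + z)⁻¹ := by
    field_simp
    ring
  have hright : (1 - ((1 - (1 + z)⁻¹ : ℝ) : ℂ)) = ((1 + z : ℝ) : ℂ)⁻¹ := by
    push_cast
    ring
  have hbase : (z : ℂ) + 1 = ((1 + z : ℝ) : ℂ) := by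
    push_cast
    ring
  have hexponent : u + v = (u - 1) + (v - 1) + (2 : ℕ) := by
    push_cast
    ring
  have harg : arg ((1 + z : ℝ) : ℂ) ≠ Real.pi := by
    rw [arg_ofReal_of_nonneg hpos.le]
    exact Real.pi_pos.ne
  rw [hright, hleft, hbase, ofReal_mul, mul_cpow_ofReal_nonneg hz.le (by positivity), ofReal_inv,
    inv_cpow _ _ harg, inv_cpow _ _ harg, abs_of_pos (by positivity), real_smul, hexponent,
    cpow_add _ _ hne, cpow_add _ _ hne, cpow_natCast]
  push_cast
  field_simp

theorem hasDerivWithinAt_one_sub_inv_one_add {z : ℝ} (hz : z ∈ Set.Ioi 0) :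
    HasDerivWithinAt (fun z : ℝ => 1 - (1 + z)⁻¹) (((1 + z) ^ 2)⁻¹) (Set.Ioi 0) z := by
  have h := (((hasDerivAt_id z).const_add 1).inv (add_pos one_pos hz).ne').const_sub 1
  simpa [neg_div] using h.hasDerivWithinAt

theorem injective_one_sub_inv_one_add : Function.Injective fun z : ℝ => 1 - (1 + z)⁻¹ :=
  fun a b h => by simpa using h

theorem integrableOn_cpow_div_add_one_cpow {u v : ℂ} (hu : 0 < u.re) (hv : 0 < v.re) :
    MeasureTheory.IntegrableOn (fun z : ℝ => (z : ℂ) ^ (u - 1) / ((z : ℂ) + 1) ^ (u + v))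
      (Set.Ioi 0) := by
  have hint := betaIntegral_convergent hu hv
  rw [intervalIntegrable_iff_integrableOn_Ioo_of_le zero_le_one, ← image_one_sub_inv_one_add_Ioi,
    MeasureTheory.integrableOn_image_iff_integrableOn_abs_deriv_smul measurableSet_Ioi
      (fun _ => hasDerivWithinAt_one_sub_inv_one_add) injective_one_sub_inv_one_add.injOn] at hint
  exact hint.congr_fun (fun z hz => abs_smul_betaIntegrand_one_sub_inv_one_add hz)
    measurableSet_Ioi

theorem integral_cpow_div_add_one_cpow {u v : ℂ} (hu : 0 < u.re) (hv : 0 < v.re) :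
    ∫ z in Set.Ioi (0 : ℝ), (z : ℂ) ^ (u - 1) / ((z : ℂ) + 1) ^ (u + v) =
      Gamma u * Gamma v / Gamma (u + v) := by
  rw [← betaIntegral_eq_Gamma_mul_div u v hu hv, betaIntegral,
    intervalIntegral.integral_of_le zero_le_one, MeasureTheory.integral_Ioc_eq_integral_Ioo,
    ← image_one_sub_inv_one_add_Ioi,
    MeasureTheory.integral_image_eq_integral_abs_deriv_smul measurableSet_Ioi
      (fun _ => hasDerivWithinAt_one_sub_inv_one_add) injective_one_sub_inv_one_add.injOn]
  exact MeasureTheory.setIntegral_congr_fun measurableSet_Ioi fun z hz =>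
    (abs_smul_betaIntegrand_one_sub_inv_one_add hz).symm

theorem Gamma_div_Gamma_add_half {u : ℂ} (hu : 0 < u.re) :
    Gamma u / Gamma (u + 1 / 2) =
      1 / (√Real.pi : ℂ) *
        ∫ z in Set.Ioi (0 : ℝ), (z : ℂ) ^ (u - 1) / ((z : ℂ) + 1) ^ (u + 1 / 2) := by
  have hpi : (√Real.pi : ℂ) ≠ 0 := ofReal_ne_zero.mpr (Real.sqrt_pos.mpr Real.pi_pos).ne'
  have hhalf : Gamma (1 / 2) = (√Real.pi : ℂ) := by
    rw [← ofReal_one, ← ofReal_ofNat, ← ofReal_div, Gamma_ofReal, Real.Gamma_one_half_eq]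
  rw [integral_cpow_div_add_one_cpow hu (by norm_num), hhalf]
  field_simp

theorem mainTheorem4 (n : ℕ) (x : ℂ) (hx : ∀ k : ℕ, x ≠ -(k : ℂ)) :
    (∀ j ∈ Finset.range (2 * n + 1),
      DifferentiableAt ℂ
        (fun s : ℂ =>
          lerchPhi (-Complex.exp (2 * Complex.I * Real.pi * j / (2 * n + 1))) s x) 0) ∧
    lerchExpProduct n x =
      1 / (Real.sqrt (2 * (1 + 2 * n)) : ℂ) *
        (Complex.Gamma ((n + x) / (2 + 4 * n)) / Complex.Gamma ((1 + 3 * n + x) / (2 + 4 * n))) ∧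
    (-(n : ℝ) < x.re →
      MeasureTheory.IntegrableOn
        (fun z : ℝ => (z : ℂ) ^ ((n + x) / (4 * n + 2) - 1) /
          ((z : ℂ) + 1) ^ ((3 * n + x + 1) / (4 * n + 2))) (Set.Ioi 0) ∧
      lerchExpProduct n x =
        1 / ((Real.sqrt (2 * Real.pi) : ℂ) * (Real.sqrt (2 * n + 1) : ℂ)) *
          ∫ z in Set.Ioi (0 : ℝ), (z : ℂ) ^ ((n + x) / (4 * n + 2) - 1) /
            ((z : ℂ) + 1) ^ ((3 * n + x + 1) / (4 * n + 2))) := by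
  refine ⟨fun j _ => differentiable_lerchPhi_neg_exp hx j 0, lerchExpProduct_eq_Gamma_div hx,
    fun hre => ?_⟩
  have hN : (4 * n + 2 : ℂ) ≠ 0 := by exact_mod_cast (4 * n + 1).succ_ne_zero
  have hu : 0 < ((n + x) / (4 * n + 2)).re := by
    rw [show (4 * n + 2 : ℂ) = (4 * n + 2 : ℝ) by push_cast; rfl, div_ofReal_re, add_re, natCast_re]
    exact div_pos (by linarith) (by positivity)
  have hexponent : (3 * n + x + 1) / (4 * n + 2) = (n + x) / (4 * n + 2) + 1 / 2 := by
    rw [div_add_div _ _ hN two_ne_zero, div_eq_div_iff hN (mul_ne_zero hN two_ne_zero)]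
    ring
  rw [hexponent]
  refine ⟨integrableOn_cpow_div_add_one_cpow hu (by norm_num), ?_⟩
  rw [lerchExpProduct_eq_Gamma_div hx, add_comm (2 : ℂ), add_assoc (1 : ℂ),
    add_comm (1 : ℂ), hexponent, Gamma_div_Gamma_add_half hu,
    Real.sqrt_mul zero_le_two, Real.sqrt_mul zero_le_two, add_comm (1 : ℝ), ofReal_mul, ofReal_mul]
  field_simp
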